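/- Consider a fixed-horizon Markov decision process with finite state space $\mathcal S$ and action space $\mathcal A$, of cardinalities $S$ and $A$, horizon $h$, initial-state distribution $p_0$, transition dynamics $\bar p$ and state-action rewards $\bar r\in\mathbb R^{SA}$. A trajectory $\tau=(s_1,a_1,\dots,s_h,a_h,s_{h+1})$ has feature vector $x\in\mathbb R^{SA}$, counting the visits to each state-action pair, and utility $\bar r^{T}x$; a deterministic policy is a map $\pi:\mathcal S\times\{1,\dots,h\}\to\mathcal A$. The true parameters are random: $\bar p$ and $\bar r$ are independently drawn from prior distributions, where almost surely $\|\bar r\|_2\le S_r$ for some constant $S_r<\infty$ and $|\bar r^{T}(x'-x)|\le\frac12$ for the feature vectors $x,x'$ of any two trajectories. Let $\pi^*=\pi_{vi}(\bar p,\bar r)$, where $\pi_{vi}(p,r)$ denotes a deterministic policy of maximal expected utility under dynamics $p$ and rewards $r$, with ties broken uniformly at random. In each iteration $i=1,2,\dots$: - $\pi_{i1}$ is drawn from a fixed distribution over deterministic policies, independently of everything else; - Dueling Posterior Sampling (DPS) chooses $\pi_{i2}$: it draws $\tilde p$ and $\tilde r$ independently from the Bayesian posterior distributions of the dynamics and of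 the rewards given all trajectories and preference labels observed so far, and sets $\pi_{i2}=\pi_{vi}(\tilde p,\tilde r)$; - trajectories $\tau_{i1},\tau_{i2}$, with feature vectors $x_{i1},x_{i2}$, are obtained by rolling out $\pi_{i1},\pi_{i2}$ under $\bar p$, and a label $y_i\in\{-\frac12,\frac12\}$ is observed, with $P(y_i=\frac12)=\bar r^{T}(x_{i2}-x_{i1})+\frac12$ (the event that $\tau_{i2}$ is preferred to $\tau_{i1}$). Let $x_i^*$ be the feature vector of the trajectory obtained in iteration $i$ if $\pi^*$ is rolled out in place of $\pi_{i2}$. Over $N$ iterations the policies $\pi_{i2}$ take $T=Nh$ actions and have one-sided Bayesian regret $$\mathbb E[\mathrm{Reg}_2(T)]=\mathbb E\Big[\sum_{i=1}^{N}\bar r^{T}(x_i^*-x_{i2})\Big],$$ the expectation being also over the prior. Then DPS achieves a one-sided asymptotic Bayesian regret rate of $S\sqrt{AT\log A/2}$: for every $\varepsilon>0$ and all sufficiently large $N$, with $T=Nh$, $$\mathbb E[\mathrm{Reg}_2(T)]\le(1+\varepsilon)\,S\sqrt{\frac{AT\log A}{2}}.$$ -/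

import Mathlib

open MeasureTheory Filter

noncomputable section

namespace DPS

/-- Transition dynamics `p`: for each state `s` and action `a`, a probability vector
`p(· | s, a)` over the next state. -/
abbrev Dynamics (S A : Type*) [Fintype S] : Type _ := S → A → stdSimplex ℝ S

/-- Reward vectors `r ∈ ℝ^(SA)` (with the Euclidean norm). -/
abbrev Rewards (S A : Type*) : Type _ := EuclideanSpace ℝ (S × A)

/-- Deterministic time-dependent policies `π : S × {1, …, h} → A`. -/
abbrev Policy (S A : Type*) (h : ℕ) : Type _ := S × Fin h → A

/-- Trajectories `s₁, a₁, …, s_h, a_h, s_{h+1}` of length `h`, stored as the sequence of states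
together with the sequence of actions. -/
abbrev Traj (S A : Type*) (h : ℕ) : Type _ := (Fin (h + 1) → S) × (Fin h → A)

/-- What is observed in one iteration: the two trajectories `τ₁`, `τ₂`, and the preference label,
`true` meaning `τ₂ ≻ τ₁` (that is, `y = 1/2`) and `false` meaning `τ₁ ≻ τ₂` (`y = -1/2`). -/
abbrev Obs (S A : Type*) (h : ℕ) : Type _ := Traj S A h × Traj S A h × Bool

/-- One iteration: the observation, and the (unobserved) trajectory `τ*` that is obtained if the
optimal policy is rolled out instead of the second policy. -/
abbrev Round (S A : Type*) (h : ℕ) : Type _ := Obs S A h × Traj S A h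

variable {S A : Type*} [Fintype S] {h : ℕ}

/-! ### The Markov decision process -/

/-- Probability of the transitions of a trajectory under given dynamics:
`∏ t, p(s_{t+1} | s_t, a_t)`. -/
def transLik (p : Dynamics S A) (τ : Traj S A h) : ENNReal :=
  ∏ t : Fin h, ENNReal.ofReal ((p (τ.1 t.castSucc) (τ.2 t)).1 (τ.1 t.succ))

/-- The trajectory of a deterministic policy along a sequence of states. -/
def follow (π : Policy S A h) (s : Fin (h + 1) → S) : Traj S A h :=
  (s, fun t => π (s t.castSucc, t))

theorem sum_path (n : ℕ) (p₀ : S → ENNReal) (hp₀ : ∑ s, p₀ s = 1)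
    (q : Fin n → S → S → ENNReal) (hq : ∀ t s, ∑ s', q t s s' = 1) :
    ∑ s : Fin (n + 1) → S, p₀ (s 0) * ∏ t : Fin n, q t (s t.castSucc) (s t.succ) = 1 := by
  induction n with
  | zero =>
    rw [← (Equiv.funUnique (Fin 1) S).symm.sum_comp]
    simpa using hp₀
  | succ n ih =>
    rw [← (Fin.snocEquiv (fun _ : Fin (n + 2) => S)).sum_comp, Fintype.sum_prod_type_right]
    rw [← ih (fun t => q t.castSucc) (fun t s => hq _ s)]
    refine Finset.sum_congr rfl fun s _ => ?_
    simp only [Fin.snocEquiv, Equiv.coe_fn_mk, Fin.prod_univ_castSucc, Fin.snoc_castSucc,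
      Fin.succ_last, Fin.snoc_last, Fin.succ_castSucc]
    have h0 : ∀ x : S, (Fin.snoc (α := fun _ => S) s x : Fin (n + 2) → S) 0 = s 0 := by
      intro x
      rw [← Fin.castSucc_zero, Fin.snoc_castSucc]
    simp only [h0, ← mul_assoc]
    rw [← Finset.mul_sum, hq, mul_one]

theorem sum_ofReal_stdSimplex (v : stdSimplex ℝ S) : ∑ s, ENNReal.ofReal (v.1 s) = 1 := by
  rw [← ENNReal.ofReal_sum_of_nonneg (fun s _ => v.2.1 s), v.2.2, ENNReal.ofReal_one]

theorem measurable_transLik (τ : Traj S A h) :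
    Measurable fun p : Dynamics S A => transLik p τ := by
  unfold transLik
  refine Finset.measurable_prod _ fun t _ => ENNReal.measurable_ofReal.comp ?_
  exact (measurable_pi_apply _).comp (measurable_subtype_coe.comp
    ((measurable_pi_apply _).comp (measurable_pi_apply _)))

variable [DecidableEq S] [Fintype A] [DecidableEq A]

/-- The law of the state sequence under policy `π`: `s₁ ∼ p₀` and
`s_{t+1} ∼ p(· | s_t, π(s_t, t))`. -/
def statePath (p₀ : PMF S) (p : Dynamics S A) (π : Policy S A h) : PMF (Fin (h + 1) → S) :=
  PMF.ofFintype (fun s => p₀ (s 0) * transLik p (follow π s)) (by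
    have h1 : ∑ s, p₀ s = 1 := by rw [← tsum_fintype (L := .unconditional S), p₀.tsum_coe]
    exact sum_path h p₀ h1
      (fun t s s' => ENNReal.ofReal ((p s (π (s, t))).1 s')) (fun t s => sum_ofReal_stdSimplex _))

/-- The law of the trajectory obtained by rolling out the policy `π`. -/
def rollout (p₀ : PMF S) (p : Dynamics S A) (π : Policy S A h) : PMF (Traj S A h) :=
  (statePath p₀ p π).map (follow π)

/-- The feature vector `x` of a trajectory: how often each state-action pair is visited. -/
def visits (τ : Traj S A h) (k : S × A) : ℕ :=
  (Finset.univ.filter fun t : Fin h => (τ.1 t.castSucc, τ.2 t) = k).card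

/-- The utility `rᵀ x` of a trajectory with feature vector `x`. -/
def utility (r : Rewards S A) (τ : Traj S A h) : ℝ :=
  ∑ k : S × A, r k * (visits τ k : ℝ)

/-- The value `V(p, r, π)` of a policy: the expected total reward in an episode. -/
def value (p₀ : PMF S) (p : Dynamics S A) (r : Rewards S A) (π : Policy S A h) : ℝ :=
  ∑ τ : Traj S A h, (rollout p₀ p π τ).toReal * utility r τ

open Classical in
/-- The deterministic policies that maximize the value. -/
def optSet (p₀ : PMF S) (p : Dynamics S A) (r : Rewards S A) :
    Finset (Policy S A h) :=
  Finset.univ.filter fun π => ∀ π' : Policy S A h, value p₀ p r π' ≤ value p₀ p r π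

theorem optSet_nonempty [Nonempty (Policy S A h)] (p₀ : PMF S) (p : Dynamics S A)
    (r : Rewards S A) : (optSet (h := h) p₀ p r).Nonempty := by
  obtain ⟨π, hπ⟩ := Finite.exists_max (fun π : Policy S A h => value p₀ p r π)
  exact ⟨π, by simpa [optSet] using hπ⟩

/-- The optimal deterministic policy `π_vi(p, r)`, ties being broken uniformly at random. -/
def optPolicy [Nonempty (Policy S A h)] (p₀ : PMF S) (p : Dynamics S A) (r : Rewards S A) :
    PMF (Policy S A h) :=
  PMF.uniformOfFinset (optSet p₀ p r) (optSet_nonempty p₀ p r)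

/-! ### Preferences: `P(τ₂ ≻ τ₁) = rᵀ (x₂ - x₁) + 1/2` -/

/-- `P(τ₂ ≻ τ₁)` under the linear link function. The truncation to `[0, 1]` is without effect
where the linear link is defined, i.e. if `rᵀ (x₂ - x₁) ∈ [-1/2, 1/2]`. -/
def prefProb (r : Rewards S A) (τ₁ τ₂ : Traj S A h) : ℝ :=
  max 0 (min 1 (utility r τ₂ - utility r τ₁ + 1 / 2))

theorem prefProb_nonneg (r : Rewards S A) (τ₁ τ₂ : Traj S A h) : 0 ≤ prefProb r τ₁ τ₂ :=
  le_max_left _ _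

theorem prefProb_le_one (r : Rewards S A) (τ₁ τ₂ : Traj S A h) : prefProb r τ₁ τ₂ ≤ 1 :=
  max_le zero_le_one (min_le_left _ _)

/-- The law of the preference label (`true` meaning `τ₂ ≻ τ₁`). -/
def label (r : Rewards S A) (τ₁ τ₂ : Traj S A h) : PMF Bool :=
  PMF.ofFintype (fun b => ENNReal.ofReal
      (if b then prefProb r τ₁ τ₂ else 1 - prefProb r τ₁ τ₂)) (by
    have h0 := prefProb_nonneg r τ₁ τ₂
    have h1 := prefProb_le_one r τ₁ τ₂
    rw [Fintype.sum_bool, if_pos rfl, if_neg Bool.false_ne_true,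
      ← ENNReal.ofReal_add h0 (by linarith)]
    simp)

/-! ### Bayesian updates -/

open Classical in
/-- Bayes' rule: the posterior proportional to `likelihood × prior`. (Where the observation has
probability zero under the prior, the posterior is undefined; the value there is immaterial.) -/
def bayesUpdate {Θ : Type*} [MeasurableSpace Θ] (μ : Measure Θ) (L : Θ → ENNReal) : Measure Θ :=
  if (∫⁻ θ, L θ ∂μ) = 0 ∨ (∫⁻ θ, L θ ∂μ) = ⊤ then μ
  else (∫⁻ θ, L θ ∂μ)⁻¹ • μ.withDensity L

instance {Θ : Type*} [MeasurableSpace Θ] (μ : Measure Θ) [IsProbabilityMeasure μ]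
    (L : Θ → ENNReal) : IsProbabilityMeasure (bayesUpdate μ L) := by
  unfold bayesUpdate
  split_ifs with h0
  · infer_instance
  · push Not at h0
    constructor
    rw [Measure.smul_apply, withDensity_apply _ MeasurableSet.univ, Measure.restrict_univ,
      smul_eq_mul, ENNReal.inv_mul_cancel h0.1 h0.2]

/-- Posterior of the dynamics given the observed history; the likelihood is that of all observed
transitions. -/
def dynPosterior (μp : Measure (Dynamics S A)) {n : ℕ} (H : Fin n → Obs S A h) :
    Measure (Dynamics S A) :=
  bayesUpdate μp fun p => ∏ i, transLik p (H i).1 * transLik p (H i).2.1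

/-- Posterior of the rewards given the observed history; the likelihood is that of all observed
preference labels. -/
def rewardPosterior (μr : Measure (Rewards S A)) {n : ℕ} (H : Fin n → Obs S A h) :
    Measure (Rewards S A) :=
  bayesUpdate μr fun r => ∏ i, label r (H i).1 (H i).2.1 (H i).2.2

instance (μp : Measure (Dynamics S A)) [IsProbabilityMeasure μp] {n : ℕ}
    (H : Fin n → Obs S A h) : IsProbabilityMeasure (dynPosterior μp H) := by
  unfold dynPosterior; infer_instance

instance (μr : Measure (Rewards S A)) [IsProbabilityMeasure μr] {n : ℕ}
    (H : Fin n → Obs S A h) : IsProbabilityMeasure (rewardPosterior μr H) := by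
  unfold rewardPosterior; infer_instance

theorem measurable_rollout (p₀ : PMF S) (π : Policy S A h) (τ : Traj S A h) :
    Measurable fun p : Dynamics S A => rollout p₀ p π τ := by
  classical
  simp only [rollout, PMF.map_apply, tsum_fintype, statePath]
  refine Finset.measurable_sum _ fun s _ => ?_
  split_ifs
  · exact (measurable_transLik _).const_mul _
  · exact measurable_const

theorem measurable_utility (τ : Traj S A h) :
    Measurable fun r : Rewards S A => utility r τ := by
  unfold utility
  fun_prop

theorem measurable_value (p₀ : PMF S) (π : Policy S A h) :
    Measurable fun m : Dynamics S A × Rewards S A => value p₀ m.1 m.2 π := by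
  unfold value
  refine Finset.measurable_sum _ fun τ _ => ?_
  exact (((measurable_rollout p₀ π τ).comp measurable_fst).ennreal_toReal).mul
    ((measurable_utility τ).comp measurable_snd)

theorem measurable_optPolicy [Nonempty (Policy S A h)] (p₀ : PMF S) (π : Policy S A h) :
    Measurable fun m : Dynamics S A × Rewards S A => optPolicy p₀ m.1 m.2 π := by
  classical
  have hset : ∀ π : Policy S A h, MeasurableSet
      {m : Dynamics S A × Rewards S A | ∀ π' : Policy S A h, value p₀ m.1 m.2 π' ≤ value p₀ m.1 m.2 π} := by
    intro π
    rw [Set.ofPred_forall]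
    exact MeasurableSet.iInter fun π' =>
      measurableSet_le (measurable_value p₀ π') (measurable_value p₀ π)
  have heq : (fun m : Dynamics S A × Rewards S A => optPolicy p₀ m.1 m.2 π) = fun m =>
      if (∀ π' : Policy S A h, value p₀ m.1 m.2 π' ≤ value p₀ m.1 m.2 π) then
        (∑ π'' : Policy S A h, if (∀ π' : Policy S A h, value p₀ m.1 m.2 π' ≤ value p₀ m.1 m.2 π'')
          then (1 : ENNReal) else 0)⁻¹ else 0 := by
    funext m
    simp [optPolicy, PMF.uniformOfFinset_apply, optSet]
  rw [heq]
  refine Measurable.ite (hset π) (Measurable.inv ?_) measurable_const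
  exact Finset.measurable_sum _ fun π'' _ =>
    Measurable.ite (hset π'') measurable_const measurable_const

/-! ### Dueling posterior sampling, one-sided -/

/-- The policy choice of DPS given the observed history: draw `p̃` and `r̃` from the posteriors of
the dynamics and of the rewards (independently), and take an optimal policy `π_vi(p̃, r̃)`. -/
def dpsPolicy [Nonempty (Policy S A h)] (p₀ : PMF S)
    (μp : Measure (Dynamics S A)) [IsProbabilityMeasure μp]
    (μr : Measure (Rewards S A)) [IsProbabilityMeasure μr] {n : ℕ} (H : Fin n → Obs S A h) :
    PMF (Policy S A h) :=
  PMF.ofFintype (fun π => ∫⁻ m, optPolicy p₀ m.1 m.2 π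
      ∂((dynPosterior μp H).prod (rewardPosterior μr H))) (by
    rw [← lintegral_finsetSum _ fun π _ => measurable_optPolicy p₀ π]
    have h1 : ∀ m : Dynamics S A × Rewards S A,
        ∑ π : Policy S A h, optPolicy p₀ m.1 m.2 π = 1 := fun m => by
      rw [← tsum_fintype (L := .unconditional _), PMF.tsum_coe]
    simp [h1])

/-- One iteration in the environment with dynamics `p` and rewards `r` after the observed history
`H`: `π₁` is drawn from the fixed distribution `ν`, `π₂` is chosen by DPS, both are rolled out and
compared; `τ*` is a rollout of the optimal policy `πstar`. -/
def round [Nonempty (Policy S A h)] (p₀ : PMF S)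
    (μp : Measure (Dynamics S A)) [IsProbabilityMeasure μp]
    (μr : Measure (Rewards S A)) [IsProbabilityMeasure μr] (ν : PMF (Policy S A h))
    (p : Dynamics S A) (r : Rewards S A) (πstar : Policy S A h)
    {n : ℕ} (H : Fin n → Obs S A h) : PMF (Round S A h) :=
  ν.bind fun π₁ =>
  (dpsPolicy p₀ μp μr H).bind fun π₂ =>
  (rollout p₀ p π₁).bind fun τ₁ =>
  (rollout p₀ p π₂).bind fun τ₂ =>
  (rollout p₀ p πstar).bind fun τs =>
  (label r τ₁ τ₂).map fun y => ((τ₁, τ₂, y), τs)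

/-- The law of the first `n` iterations, given the environment. -/
def run [Nonempty (Policy S A h)] (p₀ : PMF S)
    (μp : Measure (Dynamics S A)) [IsProbabilityMeasure μp]
    (μr : Measure (Rewards S A)) [IsProbabilityMeasure μr] (ν : PMF (Policy S A h))
    (p : Dynamics S A) (r : Rewards S A) (πstar : Policy S A h) :
    (n : ℕ) → PMF (Fin n → Round S A h)
  | 0 => PMF.pure Fin.elim0
  | n + 1 => (run p₀ μp μr ν p r πstar n).bind fun H =>
      (round p₀ μp μr ν p r πstar fun i => (H i).1).map fun z =>
        Fin.snoc (α := fun _ => Round S A h) H z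

/-- The expectation of `∑ i ≤ N, rᵀ (x*_i - x_{i2})` given the true environment `m = (p, r)`, where
`π*` is an optimal policy of the environment. -/
def condRegret [Nonempty (Policy S A h)] (p₀ : PMF S)
    (μp : Measure (Dynamics S A)) [IsProbabilityMeasure μp]
    (μr : Measure (Rewards S A)) [IsProbabilityMeasure μr] (ν : PMF (Policy S A h))
    (N : ℕ) (m : Dynamics S A × Rewards S A) : ℝ :=
  ∑ πstar : Policy S A h, (optPolicy p₀ m.1 m.2 πstar).toReal *
    ∑ H : Fin N → Round S A h, (run p₀ μp μr ν m.1 m.2 πstar N H).toReal *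
      ∑ i, (utility m.2 (H i).2 - utility m.2 (H i).1.2.1)

/-- The one-sided Bayesian regret `𝔼[Reg₂(N h)]`: the true dynamics and rewards are drawn from
the prior. -/
def bayesRegret [Nonempty (Policy S A h)] (p₀ : PMF S)
    (μp : Measure (Dynamics S A)) [IsProbabilityMeasure μp]
    (μr : Measure (Rewards S A)) [IsProbabilityMeasure μr] (ν : PMF (Policy S A h))
    (N : ℕ) : ℝ :=
  ∫ m, condRegret p₀ μp μr ν N m ∂(μp.prod μr)

end DPS

end

/-!
The Bayesian regret is in fact `o(√N)`, which lies below the claimed bound as soon as the constant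
of that bound is positive; otherwise there is only one policy and no regret at all.

Given the observed history, the policy chosen by DPS has the posterior law of the optimal policy
(`lintegral_obsRun_mul_optPolicy`): dynamics and rewards are independent under the prior and the
likelihood of a history is a product, so they remain independent. If `x_π` is the posterior
probability that `π` is optimal, the expected regret of an iteration is therefore the sum over `π`
of the posterior covariances of the event `π* = π` with the value of `π`. The value of `π` may be
replaced by its difference to the mean value of the first policy, which is the mean of the label
`y ∈ {-1/2, 1/2}` if `π` is played. So the covariance is a sum over the possible observations, in
which the likelihood of an observation given `π* = π` is compared with its likelihood under the
whole posterior. By Cauchy-Schwarz and the bound of the Hellinger distance by the relative entropy,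
the covariance is at most the root of the expected increase of `x_π log x_π` in this iteration
(`sum_abs_sub_le_sqrt_gain`); no factor `1 / x_π` appears because DPS itself plays `π` with
probability `x_π`.

Summed over the histories, these increases are the increments of the expectation of
`x_π log x_π`, which takes values in `[-1, 0]`; hence they are summable, and the partial sums of
their roots are `o(√N)` (`eventually_sum_sqrt_le`).
-/

noncomputable section

namespace DPS

/-! ### Expectations under finitely supported laws -/

/-- The expectation of a real function under a probability mass function on a finite type. -/
def expect {α : Type*} [Fintype α] (q : PMF α) (f : α → ℝ) : ℝ :=
  ∑ a, (q a).toReal * f a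

section Expect

variable {α β : Type*} [Fintype α] [Fintype β]

theorem sum_toReal_eq_one (q : PMF α) : ∑ a, (q a).toReal = 1 := by
  rw [← ENNReal.toReal_sum fun a _ => q.apply_ne_top a, ← tsum_fintype (L := .unconditional α),
    q.tsum_coe, ENNReal.toReal_one]

theorem toReal_le_one (q : PMF α) (a : α) : (q a).toReal ≤ 1 :=
  ENNReal.toReal_le_of_le_ofReal zero_le_one (by simpa using q.coe_le_one a)

theorem expect_const (q : PMF α) (c : ℝ) : expect q (fun _ => c) = c := by
  simp [expect, ← Finset.sum_mul, sum_toReal_eq_one]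

theorem expect_add (q : PMF α) (f g : α → ℝ) :
    expect q (fun a => f a + g a) = expect q f + expect q g := by
  simp [expect, mul_add, Finset.sum_add_distrib]

theorem expect_sub (q : PMF α) (f g : α → ℝ) :
    expect q (fun a => f a - g a) = expect q f - expect q g := by
  simp [expect, mul_sub, Finset.sum_sub_distrib]

theorem expect_sum {ι : Type*} (q : PMF α) (s : Finset ι) (f : ι → α → ℝ) :
    expect q (fun a => ∑ i ∈ s, f i a) = ∑ i ∈ s, expect q (f i) := by
  simp only [expect, Finset.mul_sum]
  exact Finset.sum_comm

theorem expect_bind (q : PMF α) (k : α → PMF β) (f : β → ℝ) :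
    expect (q.bind k) f = expect q fun a => expect (k a) f := by
  simp only [expect, PMF.bind_apply, tsum_fintype, Finset.mul_sum]
  rw [Finset.sum_comm]
  refine Finset.sum_congr rfl fun b _ => ?_
  rw [ENNReal.toReal_sum fun a _ =>
    ENNReal.mul_ne_top (q.apply_ne_top a) ((k a).apply_ne_top b), Finset.sum_mul]
  simp [mul_assoc]

theorem expect_pure (a : α) (f : α → ℝ) : expect (PMF.pure a) f = f a := by
  classical
  simp only [expect, PMF.pure_apply]
  rw [Finset.sum_eq_single a] <;> simp +contextual

theorem expect_map (q : PMF α) (g : α → β) (f : β → ℝ) :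
    expect (q.map g) f = expect q fun a => f (g a) := by
  rw [← PMF.bind_pure_comp, expect_bind]
  simp [expect_pure]

end Expect

/-! ### Two real inequalities -/

/-- The squared Hellinger distance is dominated by the relative entropy. The two arguments of the
distance are `y * W` and `x * W`. -/
theorem sq_sqrt_sub_sqrt_le {x y W : ℝ} (hx : 0 < x) (hy : 0 ≤ y) (hW : 0 ≤ W) :
    (√(y * W) - √(x * W)) ^ 2 ≤
      y * W * Real.log y - y * W * Real.log x - y * W + x * W := by
  rcases hy.eq_or_lt with rfl | hy
  · simp [Real.sq_sqrt (mul_nonneg hx.le hW)]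
  have hlog : 1 - √x / √y ≤ (Real.log y - Real.log x) / 2 := by
    have h1 := Real.one_sub_inv_le_log_of_pos (div_pos (Real.sqrt_pos.2 hy) (Real.sqrt_pos.2 hx))
    rw [inv_div, Real.log_div (Real.sqrt_pos.2 hy).ne' (Real.sqrt_pos.2 hx).ne',
      Real.log_sqrt hy.le, Real.log_sqrt hx.le] at h1
    linarith
  have hyx : y * (√x / √y) = √y * √x := by
    field_simp
    rw [Real.sq_sqrt hy.le]
  have h2 := mul_le_mul_of_nonneg_left hlog (mul_nonneg hy.le hW)
  have h3 : y * W * (1 - √x / √y) = y * W - √y * √x * W := by rw [← hyx]; ring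
  rw [h3] at h2
  have h4 : (√(y * W) - √(x * W)) ^ 2 = y * W + x * W - 2 * (√y * √x * W) := by
    rw [Real.sqrt_mul hy.le, Real.sqrt_mul hx.le]
    have e1 := Real.sq_sqrt hy.le
    have e2 := Real.sq_sqrt hx.le
    have e3 := Real.sq_sqrt hW
    linear_combination (√W ^ 2) * e1 + (√W ^ 2) * e2 + (y + x - 2 * √y * √x) * e3
  rw [h4]
  linarith

/-- The bounded information ratio, in a finite form. Here `w` is the mass of a history, `x` the
posterior probability of a policy being optimal given that history, `y z` the same after a further
observation `z`, `W z` and `U z` the likelihood of `z` integrated over all environments and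
over those in which the policy is optimal; `a` and `b` are the parts of the law of `z` that depend
on the choice of the policy only, for the policy in question and for the posterior mixture. The
distance between the two laws of `z` is bounded by the root of the expected gain of `x log x`. -/
theorem sum_abs_sub_le_sqrt_gain {Z : Type*} [Fintype Z] {a b U W y : Z → ℝ} {x w : ℝ}
    (ha : ∀ z, 0 ≤ a z) (hb : ∀ z, 0 ≤ b z) (hU : ∀ z, 0 ≤ U z) (hW : ∀ z, 0 ≤ W z)
    (hy : ∀ z, 0 ≤ y z) (hx : 0 ≤ x) (hab : ∀ z, x * a z ≤ b z)
    (hpost : ∀ z, b z * U z = y z * (b z * W z))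
    (haW : ∑ z, a z * W z = w) (haU : ∑ z, a z * U z = x * w)
    (hbW : ∑ z, b z * W z = w) (hbU : ∑ z, b z * U z = x * w) :
    0 ≤ ∑ z, b z * U z * Real.log (y z) - x * w * Real.log x ∧
    ∑ z, a z * |U z - x * W z| ≤
      2 * √(w * (∑ z, b z * U z * Real.log (y z) - x * w * Real.log x)) := by
  -- For `x = 0` the posterior stays zero, and both sides vanish.
  rcases hx.eq_or_lt with rfl | hx
  · have hbU0 : ∀ z, b z * U z = 0 := fun z =>
      (Finset.sum_eq_zero_iff_of_nonneg fun z _ => mul_nonneg (hb z) (hU z)).1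
        (by simpa using hbU) z (Finset.mem_univ z)
    refine ⟨by simp [hbU0], ?_⟩
    have h0 : ∑ z, a z * |U z - 0 * W z| = 0 := by
      simpa [abs_of_nonneg (hU _)] using haU
    rw [h0]
    positivity
  have hw : 0 ≤ w := haW ▸ Finset.sum_nonneg fun z _ => mul_nonneg (ha z) (hW z)
  -- Cauchy-Schwarz for `|U - x W| = |√U - √(x W)| (√U + √(x W))`.
  set d : Z → ℝ := fun z => (√(U z) - √(x * W z)) ^ 2 with hd
  have hfac : ∀ z, a z * |U z - x * W z| =
      (√(a z) * |√(U z) - √(x * W z)|) * (√(a z) * (√(U z) + √(x * W z))) := by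
    intro z
    have e1 := Real.sq_sqrt (hU z)
    have e2 := Real.sq_sqrt (mul_nonneg hx.le (hW z))
    have e3 : U z - x * W z = (√(U z) - √(x * W z)) * (√(U z) + √(x * W z)) := by
      linear_combination -e1 + e2
    rw [e3, abs_mul, abs_of_nonneg (by positivity : 0 ≤ √(U z) + √(x * W z))]
    linear_combination -(|√(U z) - √(x * W z)| * (√(U z) + √(x * W z))) * Real.sq_sqrt (ha z)
  have hcs := Real.sum_mul_le_sqrt_mul_sqrt Finset.univ
    (fun z => √(a z) * |√(U z) - √(x * W z)|) (fun z => √(a z) * (√(U z) + √(x * W z)))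
  simp only [← hfac, mul_pow, sq_abs, Real.sq_sqrt (ha _)] at hcs
  have hsum : ∑ z, a z * (√(U z) + √(x * W z)) ^ 2 ≤ 4 * (x * w) := by
    calc ∑ z, a z * (√(U z) + √(x * W z)) ^ 2
        ≤ ∑ z, (2 * (a z * U z) + 2 * x * (a z * W z)) := by
          refine Finset.sum_le_sum fun z _ => ?_
          have e1 := Real.sq_sqrt (hU z)
          have e2 := Real.sq_sqrt (mul_nonneg hx.le (hW z))
          have : (√(U z) + √(x * W z)) ^ 2 ≤ 2 * U z + 2 * (x * W z) := by
            nlinarith [sq_nonneg (√(U z) - √(x * W z))]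
          calc a z * (√(U z) + √(x * W z)) ^ 2 ≤ a z * (2 * U z + 2 * (x * W z)) :=
                mul_le_mul_of_nonneg_left this (ha z)
            _ = _ := by ring
      _ = 4 * (x * w) := by
          rw [Finset.sum_add_distrib, ← Finset.mul_sum, ← Finset.mul_sum, haU, haW]; ring
  have hgain : x * ∑ z, a z * d z ≤
      ∑ z, b z * U z * Real.log (y z) - x * w * Real.log x := by
    calc x * ∑ z, a z * d z ≤ ∑ z, b z * d z := by
          rw [Finset.mul_sum]
          refine Finset.sum_le_sum fun z _ => ?_
          rw [← mul_assoc]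
          exact mul_le_mul_of_nonneg_right (hab z) (sq_nonneg _)
      _ ≤ ∑ z, (b z * U z * Real.log (y z) - Real.log x * (b z * U z) - b z * U z
            + x * (b z * W z)) := by
          refine Finset.sum_le_sum fun z _ => ?_
          rcases (hb z).eq_or_lt with h0 | h0
          · simp [← h0]
          have hUz : U z = y z * W z := by
            have := hpost z
            rw [mul_left_comm] at this
            exact mul_left_cancel₀ h0.ne' this
          have := mul_le_mul_of_nonneg_left (sq_sqrt_sub_sqrt_le hx (hy z) (hW z)) (hb z)
          rw [← hUz] at this
          refine this.trans_eq ?_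
          ring
      _ = _ := by
          rw [Finset.sum_add_distrib, Finset.sum_sub_distrib, Finset.sum_sub_distrib,
            ← Finset.mul_sum, ← Finset.mul_sum, hbU, hbW]
          ring
  have hd0 : 0 ≤ ∑ z, a z * d z :=
    Finset.sum_nonneg fun z _ => mul_nonneg (ha z) (sq_nonneg _)
  refine ⟨(mul_nonneg hx.le hd0).trans hgain, ?_⟩
  calc ∑ z, a z * |U z - x * W z| ≤ √(∑ z, a z * d z) * √(4 * (x * w)) :=
        hcs.trans (mul_le_mul_of_nonneg_left (Real.sqrt_le_sqrt hsum) (Real.sqrt_nonneg _))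
    _ = 2 * √(w * (x * ∑ z, a z * d z)) := by
        rw [← Real.sqrt_mul hd0, show (∑ z, a z * d z) * (4 * (x * w)) =
          2 ^ 2 * (w * (x * ∑ z, a z * d z)) by ring, Real.sqrt_mul (by norm_num),
          Real.sqrt_sq (by norm_num)]
    _ ≤ _ := by gcongr

/-- If `D` is summable then the partial sums of `√D` are `o(√N)`. -/
theorem eventually_sum_sqrt_le {D : ℕ → ℝ} (hD : ∀ n, 0 ≤ D n) (hs : Summable D) {δ : ℝ}
    (hδ : 0 < δ) : ∀ᶠ N : ℕ in atTop, ∑ n ∈ Finset.range N, √(D n) ≤ δ * √(N : ℝ) := by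
  -- Beyond `K` the sum of `D` is below `(δ / 2) ^ 2`, so Cauchy-Schwarz bounds the roots there by
  -- `δ / 2 * √N`; the finitely many terms before `K` are absorbed by another `δ / 2 * √N`.
  obtain ⟨K, hK⟩ : ∃ K : ℕ, ∑' n, D (n + K) < (δ / 2) ^ 2 :=
    ((tendsto_sum_nat_add D).eventually_lt_const (by positivity)).exists
  have hlim : Tendsto (fun N : ℕ => δ / 2 * √(N : ℝ)) atTop atTop :=
    (Real.tendsto_sqrt_atTop.comp tendsto_natCast_atTop_atTop).const_mul_atTop (by positivity)
  filter_upwards [hlim.eventually_ge_atTop (∑ n ∈ Finset.range K, √(D n)),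
    eventually_ge_atTop K] with N hN hKN
  obtain ⟨M, rfl⟩ := Nat.exists_eq_add_of_le hKN
  rw [Finset.sum_range_add]
  have hcs : ∑ n ∈ Finset.range M, √(D (K + n)) ≤
      √(∑ n ∈ Finset.range M, (1 : ℝ) ^ 2) * √(∑ n ∈ Finset.range M, √(D (K + n)) ^ 2) := by
    simpa using Real.sum_mul_le_sqrt_mul_sqrt (Finset.range M) (fun _ => 1)
      (fun n => √(D (K + n)))
  have htail : ∑ n ∈ Finset.range M, √(D (K + n)) ^ 2 ≤ (δ / 2) ^ 2 := by
    simp only [Real.sq_sqrt (hD _), add_comm K]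
    exact (((summable_nat_add_iff K).2 hs).sum_le_tsum _ fun n _ => hD _).trans hK.le
  have hM : ∑ n ∈ Finset.range M, (1 : ℝ) ^ 2 ≤ ((K + M : ℕ) : ℝ) := by
    simp
  have : ∑ n ∈ Finset.range M, √(D (K + n)) ≤ √((K + M : ℕ) : ℝ) * (δ / 2) := by
    refine hcs.trans (mul_le_mul (Real.sqrt_le_sqrt hM) ?_ (Real.sqrt_nonneg _)
      (Real.sqrt_nonneg _))
    exact (Real.sqrt_le_sqrt htail).trans_eq (Real.sqrt_sq (by positivity))
  linarith

variable {S A : Type*} [Fintype S] [DecidableEq S] [Fintype A] [DecidableEq A] {h : ℕ}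

/-! ### The law of the observed history -/

theorem rollout_apply (p₀ : PMF S) (p : Dynamics S A) (π : Policy S A h) (τ : Traj S A h) :
    rollout p₀ p π τ = (if follow π τ.1 = τ then p₀ (τ.1 0) else 0) * transLik p τ := by
  have hpath : ∀ s, statePath p₀ p π s = p₀ (s 0) * transLik p (follow π s) := fun _ => rfl
  simp only [rollout, PMF.map_apply, tsum_fintype, hpath]
  rw [Finset.sum_eq_single τ.1]
  · by_cases hτ : follow π τ.1 = τ
    · rw [if_pos hτ.symm, if_pos hτ, hτ]
    · rw [if_neg fun e => hτ e.symm, if_neg hτ, zero_mul]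
  · intro s _ hs
    exact if_neg fun e => hs (congrArg Prod.fst e).symm
  · simp

/-- The law of the observation if the first policy is drawn from `ν` and the second one is `π`. -/
def duel (p₀ : PMF S) (ν : PMF (Policy S A h)) (m : Dynamics S A × Rewards S A)
    (π : Policy S A h) : PMF (Obs S A h) :=
  ν.bind fun π₁ =>
  (rollout p₀ m.1 π₁).bind fun τ₁ =>
  (rollout p₀ m.1 π).bind fun τ₂ =>
  (label m.2 τ₁ τ₂).map fun y => (τ₁, τ₂, y)

/-- The factor of the law `duel` that does not depend on the environment: the probability of the
initial states and of the actions. -/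
def duelWeight (p₀ : PMF S) (ν : PMF (Policy S A h)) (π : Policy S A h) (z : Obs S A h) :
    ENNReal :=
  (∑ π₁, ν π₁ * if follow π₁ z.1.1 = z.1 then p₀ (z.1.1 0) else 0) *
    if follow π z.2.1.1 = z.2.1 then p₀ (z.2.1.1 0) else 0

/-- The factor of the law `duel` that depends on the environment. -/
def obsLik (m : Dynamics S A × Rewards S A) (z : Obs S A h) : ENNReal :=
  transLik m.1 z.1 * transLik m.1 z.2.1 * label m.2 z.1 z.2.1 z.2.2

theorem label_map_apply (r : Rewards S A) (τ₁ τ₂ : Traj S A h) (z : Obs S A h) :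
    ((label r τ₁ τ₂).map fun y => ((τ₁, τ₂, y) : Obs S A h)) z =
      if τ₁ = z.1 then if τ₂ = z.2.1 then label r τ₁ τ₂ z.2.2 else 0 else 0 := by
  obtain ⟨t₁, t₂, y⟩ := z
  rw [PMF.map_apply, tsum_fintype]
  by_cases h1 : τ₁ = t₁
  · by_cases h2 : τ₂ = t₂
    · subst h1 h2
      simp
    · simp [h2, Ne.symm h2]
  · simp [h1, Ne.symm h1]

theorem duel_apply (p₀ : PMF S) (ν : PMF (Policy S A h)) (m : Dynamics S A × Rewards S A)
    (π : Policy S A h) (z : Obs S A h) :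
    duel p₀ ν m π z = duelWeight p₀ ν π z * obsLik m z := by
  simp only [duel, PMF.bind_apply, tsum_fintype, label_map_apply, mul_ite, mul_zero,
    Finset.sum_ite_eq', Finset.mem_univ, if_true, Finset.sum_ite_irrel,
    Finset.sum_const_zero, rollout_apply, duelWeight, obsLik, Finset.sum_mul]
  by_cases h2 : follow π z.2.1.1 = z.2.1
  · simp only [if_pos h2, Finset.sum_mul]
    refine Finset.sum_congr rfl fun π₁ _ => ?_
    split_ifs <;> ring
  · simp [h2]

theorem transLik_le_one (p : Dynamics S A) (τ : Traj S A h) : transLik p τ ≤ 1 := by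
  refine Finset.prod_le_one' fun t _ => ENNReal.ofReal_le_one.2 ?_
  have hv := (p (τ.1 t.castSucc) (τ.2 t)).2
  rw [← hv.2]
  exact Finset.single_le_sum (fun s _ => hv.1 s) (Finset.mem_univ _)

theorem measurable_label (τ₁ τ₂ : Traj S A h) (b : Bool) :
    Measurable fun r : Rewards S A => label r τ₁ τ₂ b := by
  have hp : Measurable fun r : Rewards S A => prefProb r τ₁ τ₂ := by
    unfold prefProb
    have h1 := measurable_utility (S := S) (A := A) τ₁
    have h2 := measurable_utility (S := S) (A := A) τ₂
    fun_prop
  simp only [label, PMF.ofFintype_apply]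
  cases b
  · simpa using (hp.const_sub 1).ennreal_ofReal
  · simpa using hp.ennreal_ofReal

theorem measurable_obsLik (z : Obs S A h) :
    Measurable fun m : Dynamics S A × Rewards S A => obsLik m z := by
  unfold obsLik
  exact (((measurable_transLik _).comp measurable_fst).mul
    ((measurable_transLik _).comp measurable_fst)).mul
      ((measurable_label _ _ _).comp measurable_snd)

section History

variable [Nonempty (Policy S A h)]

/-- The law of the observations of the first `n` iterations in the environment `m`. -/
def obsRun (p₀ : PMF S)
    (μp : Measure (Dynamics S A)) [IsProbabilityMeasure μp]
    (μr : Measure (Rewards S A)) [IsProbabilityMeasure μr] (ν : PMF (Policy S A h))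
    (m : Dynamics S A × Rewards S A) : (n : ℕ) → PMF (Fin n → Obs S A h)
  | 0 => PMF.pure Fin.elim0
  | n + 1 => (obsRun p₀ μp μr ν m n).bind fun H =>
      ((dpsPolicy p₀ μp μr H).bind (duel p₀ ν m)).map fun z =>
        Fin.snoc (α := fun _ => Obs S A h) H z

variable (p₀ : PMF S) (μp : Measure (Dynamics S A)) [IsProbabilityMeasure μp]
  (μr : Measure (Rewards S A)) [IsProbabilityMeasure μr] (ν : PMF (Policy S A h))

/-- The rollout of the optimal policy does not influence what is observed. -/
theorem round_map_fst (m : Dynamics S A × Rewards S A) (πstar : Policy S A h) {n : ℕ}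
    (H : Fin n → Obs S A h) :
    (round p₀ μp μr ν m.1 m.2 πstar H).map Prod.fst =
      (dpsPolicy p₀ μp μr H).bind (duel p₀ ν m) := by
  unfold round duel
  simp only [PMF.map_bind, PMF.map_comp, Function.comp_def, PMF.bind_const]
  exact PMF.bind_comm _ _ _

theorem run_map_obs (m : Dynamics S A × Rewards S A) (πstar : Policy S A h) (n : ℕ) :
    (run p₀ μp μr ν m.1 m.2 πstar n).map (fun H i => (H i).1) = obsRun p₀ μp μr ν m n := by
  induction n with
  | zero =>
    rw [run, obsRun, PMF.pure_map]
    exact congrArg PMF.pure (Subsingleton.elim _ _)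
  | succ n ih =>
    have hsnoc : ∀ (H : Fin n → Round S A h) (z : Round S A h),
        (fun i => ((Fin.snoc (α := fun _ => Round S A h) H z : Fin (n + 1) → Round S A h) i).1) =
          Fin.snoc (α := fun _ => Obs S A h) (fun i => (H i).1) z.1 := by
      intro H z
      funext i
      refine Fin.lastCases ?_ (fun i => ?_) i <;> simp
    rw [run, obsRun, ← ih, PMF.map_bind, PMF.bind_map]
    refine congrArg _ (funext fun H => ?_)
    simp only [Function.comp_def]
    rw [← round_map_fst p₀ μp μr ν m πstar, PMF.map_comp, PMF.map_comp]
    exact congrArg (fun g => PMF.map g _) (funext fun z => hsnoc H z)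

/-- The factor that does not depend on the environment in the law of an observation when the
second policy is chosen by DPS. -/
def dpsWeight {n : ℕ} (H : Fin n → Obs S A h) (z : Obs S A h) : ENNReal :=
  ∑ π, dpsPolicy p₀ μp μr H π * duelWeight p₀ ν π z

theorem dps_bind_duel_apply (m : Dynamics S A × Rewards S A) {n : ℕ} (H : Fin n → Obs S A h)
    (z : Obs S A h) :
    ((dpsPolicy p₀ μp μr H).bind (duel p₀ ν m)) z = dpsWeight p₀ μp μr ν H z * obsLik m z := by
  simp only [PMF.bind_apply, tsum_fintype, duel_apply, dpsWeight, Finset.sum_mul, mul_assoc]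

theorem obsRun_snoc (m : Dynamics S A × Rewards S A) {n : ℕ} (H : Fin n → Obs S A h)
    (z : Obs S A h) :
    obsRun p₀ μp μr ν m (n + 1) (Fin.snoc (α := fun _ => Obs S A h) H z) =
      obsRun p₀ μp μr ν m n H * (dpsWeight p₀ μp μr ν H z * obsLik m z) := by
  rw [obsRun, PMF.bind_apply, tsum_fintype, Finset.sum_eq_single H]
  · rw [PMF.map_apply, tsum_fintype, Finset.sum_eq_single z]
    · rw [if_pos rfl, dps_bind_duel_apply]
    · intro z' _ hz
      exact if_neg fun e => hz (Fin.snoc_injective2 e).2.symm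
    · simp
  · intro H' _ hH
    rw [PMF.map_apply, tsum_fintype, Finset.sum_eq_zero, mul_zero]
    intro z' _
    exact if_neg fun e => hH (Fin.snoc_injective2 e).1.symm
  · simp

/-- The likelihood of a history is the product of the likelihoods used by the two posteriors, up
to a factor that does not depend on the environment. -/
theorem exists_obsRun_eq (n : ℕ) : ∃ c : (Fin n → Obs S A h) → ENNReal,
    ∀ (m : Dynamics S A × Rewards S A) (H : Fin n → Obs S A h),
      obsRun p₀ μp μr ν m n H = c H *
        ((∏ i, transLik m.1 (H i).1 * transLik m.1 (H i).2.1) *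
          ∏ i, label m.2 (H i).1 (H i).2.1 (H i).2.2) := by
  induction n with
  | zero =>
    refine ⟨fun _ => 1, fun m H => ?_⟩
    simp [obsRun, Subsingleton.elim H Fin.elim0]
  | succ n ih =>
    obtain ⟨c, hc⟩ := ih
    refine ⟨fun H => c (Fin.init H) * dpsWeight p₀ μp μr ν (Fin.init H) (H (Fin.last n)),
      fun m H => ?_⟩
    conv_lhs => rw [← Fin.snoc_init_self H]
    rw [obsRun_snoc, hc, Fin.prod_univ_castSucc, Fin.prod_univ_castSucc]
    simp only [obsLik, Fin.init]
    ring

/-! ### DPS samples from the posterior law of the optimal policy -/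

theorem measurable_obsRun {n : ℕ} (H : Fin n → Obs S A h) :
    Measurable fun m : Dynamics S A × Rewards S A => obsRun p₀ μp μr ν m n H := by
  obtain ⟨c, hc⟩ := exists_obsRun_eq p₀ μp μr ν n
  simp only [hc]
  refine Measurable.const_mul (Measurable.mul ?_ ?_) _
  · exact Finset.measurable_prod _ fun i _ => ((measurable_transLik _).comp measurable_fst).mul
      ((measurable_transLik _).comp measurable_fst)
  · exact Finset.measurable_prod _ fun i _ => (measurable_label _ _ _).comp measurable_snd

/-- Also valid for an observation of probability zero, where the value of `bayesUpdate` is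
immaterial: both sides vanish. -/
theorem lintegral_smul_bayesUpdate {Θ : Type*} [MeasurableSpace Θ] (μ : Measure Θ)
    {L : Θ → ENNReal} (hL : Measurable L) (htop : ∫⁻ θ, L θ ∂μ ≠ ⊤) :
    (∫⁻ θ, L θ ∂μ) • bayesUpdate μ L = μ.withDensity L := by
  by_cases h0 : ∫⁻ θ, L θ ∂μ = 0
  · rw [h0, zero_smul, (withDensity_eq_zero_iff hL.aemeasurable).2 ((lintegral_eq_zero_iff hL).1 h0)]
  · rw [bayesUpdate, if_neg (not_or.2 ⟨h0, htop⟩), smul_smul, ENNReal.mul_inv_cancel h0 htop,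
      one_smul]

/-- The independent posteriors of dynamics and rewards are together the posterior of the
environment, so the policy chosen by DPS has the posterior law of the optimal policy. -/
theorem lintegral_obsRun_mul_optPolicy {n : ℕ} (H : Fin n → Obs S A h) (π : Policy S A h) :
    ∫⁻ m, obsRun p₀ μp μr ν m n H * optPolicy p₀ m.1 m.2 π ∂(μp.prod μr) =
      dpsPolicy p₀ μp μr H π * ∫⁻ m, obsRun p₀ μp μr ν m n H ∂(μp.prod μr) := by
  obtain ⟨c, hc⟩ := exists_obsRun_eq p₀ μp μr ν n
  set Lp : Dynamics S A → ENNReal := fun p => ∏ i, transLik p (H i).1 * transLik p (H i).2.1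
    with hLp
  set Lr : Rewards S A → ENNReal := fun r => ∏ i, label r (H i).1 (H i).2.1 (H i).2.2 with hLr
  have mp : Measurable Lp :=
    Finset.measurable_prod _ fun i _ => (measurable_transLik _).mul (measurable_transLik _)
  have mr : Measurable Lr := Finset.measurable_prod _ fun i _ => measurable_label _ _ _
  have tp : ∫⁻ p, Lp p ∂μp ≠ ⊤ := by
    refine ne_top_of_le_ne_top ENNReal.one_ne_top ((lintegral_mono fun p => ?_).trans_eq
      (lintegral_one.trans (measure_univ (μ := μp))))
    exact Finset.prod_le_one' fun i _ => mul_le_one' (transLik_le_one _ _) (transLik_le_one _ _)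
  have tr : ∫⁻ r, Lr r ∂μr ≠ ⊤ := by
    refine ne_top_of_le_ne_top ENNReal.one_ne_top ((lintegral_mono fun r => ?_).trans_eq
      (lintegral_one.trans (measure_univ (μ := μr))))
    exact Finset.prod_le_one' fun i _ => PMF.coe_le_one _ _
  have mprod : Measurable fun m : Dynamics S A × Rewards S A => Lp m.1 * Lr m.2 :=
    (mp.comp measurable_fst).mul (mr.comp measurable_snd)
  have key : ∀ f : Dynamics S A × Rewards S A → ENNReal, Measurable f →
      ∫⁻ m, obsRun p₀ μp μr ν m n H * f m ∂(μp.prod μr) =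
        c H * (((∫⁻ p, Lp p ∂μp) * ∫⁻ r, Lr r ∂μr) *
          ∫⁻ m, f m ∂((dynPosterior μp H).prod (rewardPosterior μr H))) := by
    intro f hf
    have hm : (μp.prod μr).withDensity (fun m => Lp m.1 * Lr m.2) =
        (∫⁻ p, Lp p ∂μp) • (∫⁻ r, Lr r ∂μr) •
          (dynPosterior μp H).prod (rewardPosterior μr H) := by
      have : SFinite (μr.withDensity Lr) := inferInstance
      rw [← prod_withDensity mp mr, ← lintegral_smul_bayesUpdate μp mp tp,
        ← lintegral_smul_bayesUpdate μr mr tr, Measure.prod_smul_left, Measure.prod_smul_right]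
      rfl
    calc ∫⁻ m, obsRun p₀ μp μr ν m n H * f m ∂(μp.prod μr)
        = ∫⁻ m, c H * ((Lp m.1 * Lr m.2) * f m) ∂(μp.prod μr) := by
          simp only [hc, mul_assoc, hLp, hLr]
      _ = c H * ∫⁻ m, (Lp m.1 * Lr m.2) * f m ∂(μp.prod μr) :=
          lintegral_const_mul _ (mprod.mul hf)
      _ = _ := by
          congr 1
          have := lintegral_withDensity_eq_lintegral_mul (μp.prod μr) mprod hf
          simp only [Pi.mul_apply] at this
          rw [← this, hm, lintegral_smul_measure, lintegral_smul_measure]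
          simp only [smul_eq_mul, mul_assoc]
  have h1 := key (fun _ => 1) measurable_const
  simp only [mul_one, lintegral_one, measure_univ] at h1
  rw [key _ (measurable_optPolicy p₀ π), h1, dpsPolicy, PMF.ofFintype_apply]
  ring

end History

/-! ### Bounded functions of the environment -/

theorem memLp_top_toReal {Θ : Type*} [MeasurableSpace Θ] {μ : Measure Θ} {f : Θ → ENNReal}
    (hf : Measurable f) (h1 : ∀ θ, f θ ≤ 1) : MemLp (fun θ => (f θ).toReal) ⊤ μ := by
  refine memLp_top_of_bound hf.ennreal_toReal.aestronglyMeasurable 1 (ae_of_all _ fun θ => ?_)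
  rw [Real.norm_of_nonneg ENNReal.toReal_nonneg]
  exact ENNReal.toReal_le_of_le_ofReal zero_le_one (by simpa using h1 θ)

theorem memLp_top_value (p₀ : PMF S) (μp : Measure (Dynamics S A)) [IsProbabilityMeasure μp]
    (μr : Measure (Rewards S A)) [IsProbabilityMeasure μr]
    {Sr : ℝ} (hSr : ∀ᵐ r ∂μr, ‖r‖ ≤ Sr) (π : Policy S A h) :
    MemLp (fun m : Dynamics S A × Rewards S A => value p₀ m.1 m.2 π) ⊤ (μp.prod μr) := by
  have hcoord : ∀ k : S × A,
      MemLp (fun m : Dynamics S A × Rewards S A => m.2 k) ⊤ (μp.prod μr) := by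
    intro k
    have hmeas : Measurable fun m : Dynamics S A × Rewards S A => m.2 k :=
      (by fun_prop : Measurable fun r : Rewards S A => r k).comp measurable_snd
    refine memLp_top_of_bound hmeas.aestronglyMeasurable Sr ?_
    filter_upwards [Measure.quasiMeasurePreserving_snd.ae hSr] with m hm
    exact (PiLp.norm_apply_le m.2 k).trans hm
  unfold value utility
  refine memLp_finsetSum _ fun τ _ => MemLp.mul' (q := ⊤) (p := ⊤)
    (memLp_finsetSum _ fun k _ => (hcoord k).mul_const _) ?_
  exact memLp_top_toReal ((measurable_rollout p₀ π τ).comp measurable_fst)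
    fun m => PMF.coe_le_one _ _

theorem memLp_top_optPolicy [Nonempty (Policy S A h)] (p₀ : PMF S)
    (μ : Measure (Dynamics S A × Rewards S A)) (π : Policy S A h) :
    MemLp (fun m : Dynamics S A × Rewards S A => (optPolicy p₀ m.1 m.2 π).toReal) ⊤ μ :=
  memLp_top_toReal (measurable_optPolicy p₀ π) fun _ => PMF.coe_le_one _ _

theorem memLp_top_obsLik (μ : Measure (Dynamics S A × Rewards S A)) (z : Obs S A h) :
    MemLp (fun m : Dynamics S A × Rewards S A => (obsLik m z).toReal) ⊤ μ :=
  memLp_top_toReal (measurable_obsLik z) fun _ =>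
    mul_le_one' (mul_le_one' (transLik_le_one _ _) (transLik_le_one _ _)) (PMF.coe_le_one _ _)

/-- If the law `k m` of an observation factors into a part `a` free of the environment and the
likelihood, then integrating it against the environment preserves mass. -/
theorem sum_mul_integral_obsLik {μ : Measure (Dynamics S A × Rewards S A)} [IsFiniteMeasure μ]
    {k : Dynamics S A × Rewards S A → PMF (Obs S A h)} {a : Obs S A h → ENNReal}
    (hk : ∀ m z, k m z = a z * obsLik m z) {f : Dynamics S A × Rewards S A → ℝ}
    (hf : MemLp f ⊤ μ) :
    ∑ z, (a z).toReal * ∫ m, f m * (obsLik m z).toReal ∂μ = ∫ m, f m ∂μ := by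
  have hint : ∀ z : Obs S A h, Integrable (fun m => f m * (obsLik m z).toReal) μ := fun z =>
    (MemLp.mul' (q := ⊤) (p := ⊤) (r := ⊤) (memLp_top_obsLik μ z) hf).integrable le_top
  simp only [← integral_const_mul]
  rw [← integral_finsetSum _ fun z _ => (hint z).const_mul _]
  refine integral_congr_ae (ae_of_all _ fun m => ?_)
  have h1 := sum_toReal_eq_one (k m)
  simp only [hk, ENNReal.toReal_mul] at h1
  simp only [mul_left_comm _ (f m), ← Finset.mul_sum, h1, mul_one]

/-! ### The regret of one iteration -/

/-- Where the linear link is valid, the mean of the label is the difference of the values. -/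
theorem expect_duel_label (p₀ : PMF S) (ν : PMF (Policy S A h))
    (m : Dynamics S A × Rewards S A) (π : Policy S A h)
    (hm : ∀ τ₁ τ₂ : Traj S A h, |utility m.2 τ₂ - utility m.2 τ₁| ≤ 1 / 2) :
    expect (duel p₀ ν m π) (fun z => if z.2.2 then 1 / 2 else -(1 / 2)) =
      value p₀ m.1 m.2 π - expect ν (value p₀ m.1 m.2) := by
  have hlabel : ∀ τ₁ τ₂ : Traj S A h,
      expect (label m.2 τ₁ τ₂) (fun y => if y then (1 / 2 : ℝ) else -(1 / 2)) =
        utility m.2 τ₂ - utility m.2 τ₁ := by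
    intro τ₁ τ₂
    have h1 := abs_le.1 (hm τ₁ τ₂)
    have hp : prefProb m.2 τ₁ τ₂ = utility m.2 τ₂ - utility m.2 τ₁ + 1 / 2 := by
      rw [prefProb, min_eq_right (by linarith), max_eq_right (by linarith)]
    simp only [expect, label, PMF.ofFintype_apply, Fintype.sum_bool, if_true, hp]
    rw [ENNReal.toReal_ofReal (by linarith)]
    simp only [Bool.false_eq_true, if_false]
    rw [ENNReal.toReal_ofReal (by linarith)]
    ring
  simp only [duel, expect_bind, expect_map, hlabel, expect_sub, expect_const]
  rfl

theorem duelWeight_ne_top (p₀ : PMF S) (ν : PMF (Policy S A h)) (π : Policy S A h) (z : Obs S A h) : duelWeight p₀ ν π z ≠ ⊤ := by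
  refine ENNReal.mul_ne_top (ENNReal.sum_ne_top.2 fun π₁ _ =>
    ENNReal.mul_ne_top (ν.apply_ne_top _) ?_) ?_ <;>
  · split_ifs
    · exact p₀.apply_ne_top _
    · exact ENNReal.zero_ne_top

variable [Nonempty (Policy S A h)]

variable (p₀ : PMF S) (μp : Measure (Dynamics S A)) [IsProbabilityMeasure μp]
  (μr : Measure (Rewards S A)) [IsProbabilityMeasure μr] (ν : PMF (Policy S A h))

/-- The expected regret of iteration `n` (counted from `0`) in the environment `m`. -/
def roundRegret (n : ℕ) (m : Dynamics S A × Rewards S A) : ℝ :=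
  expect (obsRun p₀ μp μr ν m n) fun H =>
    ∑ π, ((optPolicy p₀ m.1 m.2 π).toReal - (dpsPolicy p₀ μp μr H π).toReal) *
      value p₀ m.1 m.2 π

theorem expect_round (m : Dynamics S A × Rewards S A) (πstar : Policy S A h) {n : ℕ}
    (H : Fin n → Obs S A h) :
    expect (round p₀ μp μr ν m.1 m.2 πstar H)
        (fun z => utility m.2 z.2 - utility m.2 z.1.2.1) =
      value p₀ m.1 m.2 πstar - expect (dpsPolicy p₀ μp μr H) (value p₀ m.1 m.2) := by
  simp only [round, expect_bind, expect_map, expect_sub, expect_const]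
  rfl

theorem expect_run (m : Dynamics S A × Rewards S A) (πstar : Policy S A h) (N : ℕ) :
    expect (run p₀ μp μr ν m.1 m.2 πstar N)
        (fun H => ∑ i, (utility m.2 (H i).2 - utility m.2 (H i).1.2.1)) =
      ∑ n ∈ Finset.range N, expect (obsRun p₀ μp μr ν m n) fun H =>
        value p₀ m.1 m.2 πstar - expect (dpsPolicy p₀ μp μr H) (value p₀ m.1 m.2) := by
  induction N with
  | zero => simp [run, expect_pure]
  | succ N ih =>
    rw [Finset.sum_range_succ, ← ih, run, expect_bind, ← run_map_obs p₀ μp μr ν m πstar N,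
      expect_map, ← expect_add]
    simp only [expect_map, Fin.sum_univ_castSucc, Fin.snoc_castSucc, Fin.snoc_last, expect_add,
      expect_const, expect_round]

theorem condRegret_eq_sum (N : ℕ) (m : Dynamics S A × Rewards S A) :
    condRegret p₀ μp μr ν N m = ∑ n ∈ Finset.range N, roundRegret p₀ μp μr ν n m := by
  have h1 : condRegret p₀ μp μr ν N m = expect (optPolicy p₀ m.1 m.2) fun πstar =>
      expect (run p₀ μp μr ν m.1 m.2 πstar N)
        (fun H => ∑ i, (utility m.2 (H i).2 - utility m.2 (H i).1.2.1)) := rfl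
  have h2 : ∀ n, roundRegret p₀ μp μr ν n m =
      expect (optPolicy (h := h) p₀ m.1 m.2) (value p₀ m.1 m.2) -
        expect (obsRun p₀ μp μr ν m n)
          fun H : Fin n → Obs S A h =>
            expect (dpsPolicy p₀ μp μr H) (value p₀ m.1 m.2) := by
    intro n
    simp only [roundRegret, sub_mul, Finset.sum_sub_distrib]
    exact (expect_sub _ _ _).trans (congrArg (· - _) (expect_const _ _))
  simp only [h1, h2, expect_run]
  simp only [expect_sub, expect_const, expect_sum]

theorem memLp_top_obsRun {n : ℕ} (μ : Measure (Dynamics S A × Rewards S A))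
    (H : Fin n → Obs S A h) :
    MemLp (fun m => (obsRun p₀ μp μr ν m n H).toReal) ⊤ μ :=
  memLp_top_toReal (measurable_obsRun p₀ μp μr ν H) fun _ => PMF.coe_le_one _ _

theorem integrable_roundRegret {Sr : ℝ} (hSr : ∀ᵐ r ∂μr, ‖r‖ ≤ Sr) (n : ℕ) :
    Integrable (roundRegret p₀ μp μr ν n) (μp.prod μr) := by
  unfold roundRegret expect
  refine MemLp.integrable (q := ⊤) le_top (memLp_finsetSum _ fun H _ =>
    MemLp.mul' (q := ⊤) (p := ⊤) (memLp_finsetSum _ fun π _ => MemLp.mul' (q := ⊤) (p := ⊤)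
      (memLp_top_value p₀ μp μr hSr π) ?_) (memLp_top_obsRun p₀ μp μr ν _ H))
  exact (memLp_top_optPolicy p₀ _ π).sub (memLp_const _)

theorem integral_obsRun_mul_optPolicy {n : ℕ} (H : Fin n → Obs S A h) (π : Policy S A h) :
    ∫ m, (obsRun p₀ μp μr ν m n H).toReal * (optPolicy p₀ m.1 m.2 π).toReal ∂(μp.prod μr) =
      (dpsPolicy p₀ μp μr H π).toReal *
        ∫ m, (obsRun p₀ μp μr ν m n H).toReal ∂(μp.prod μr) := by
  have m1 := measurable_obsRun p₀ μp μr ν H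
  have m2 := measurable_optPolicy (S := S) (A := A) p₀ π
  have m3 : Measurable fun m : Dynamics S A × Rewards S A =>
      obsRun p₀ μp μr ν m n H * optPolicy p₀ m.1 m.2 π := m1.mul m2
  simp only [← ENNReal.toReal_mul]
  rw [integral_toReal m3.aemeasurable (ae_of_all _ fun m => ENNReal.mul_lt_top
      (PMF.apply_lt_top _ _) (PMF.apply_lt_top _ _)),
    integral_toReal m1.aemeasurable (ae_of_all _ fun m => PMF.apply_lt_top _ _),
    lintegral_obsRun_mul_optPolicy, ENNReal.toReal_mul]

/-- The expected value of `x log x`, where `x` is the posterior probability of the policy `π`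
being optimal after `n` iterations. Summed over `π` it is minus the expected posterior entropy of
the optimal policy. The convention `log 0 = 0` gives the usual value `0 log 0 = 0`. -/
def expLogPosterior (n : ℕ) (π : Policy S A h) : ℝ :=
  ∑ H : Fin n → Obs S A h, (dpsPolicy p₀ μp μr H π).toReal *
    (∫ m, (obsRun p₀ μp μr ν m n H).toReal ∂(μp.prod μr)) *
      Real.log (dpsPolicy p₀ μp μr H π).toReal

theorem sum_integral_obsRun (n : ℕ) :
    ∑ H : Fin n → Obs S A h, ∫ m, (obsRun p₀ μp μr ν m n H).toReal ∂(μp.prod μr) = 1 := by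
  rw [← integral_finsetSum _ fun H _ =>
    (memLp_top_obsRun p₀ μp μr ν (μp.prod μr) H).integrable le_top]
  simp [sum_toReal_eq_one]

theorem expLogPosterior_nonpos (n : ℕ) (π : Policy S A h) :
    expLogPosterior p₀ μp μr ν n π ≤ 0 := by
  refine Finset.sum_nonpos fun H _ => mul_nonpos_of_nonneg_of_nonpos
    (mul_nonneg ENNReal.toReal_nonneg (integral_nonneg fun m => ENNReal.toReal_nonneg))
    (Real.log_nonpos ENNReal.toReal_nonneg (toReal_le_one _ _))

theorem neg_one_le_expLogPosterior (n : ℕ) (π : Policy S A h) :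
    -1 ≤ expLogPosterior p₀ μp μr ν n π := by
  rw [← sum_integral_obsRun p₀ μp μr ν n, ← Finset.sum_neg_distrib]
  refine Finset.sum_le_sum fun H _ => ?_
  set x := (dpsPolicy p₀ μp μr H π).toReal with hx
  have hx0 : 0 ≤ x := ENNReal.toReal_nonneg
  have hw : 0 ≤ ∫ m, (obsRun p₀ μp μr ν m n H).toReal ∂(μp.prod μr) :=
    integral_nonneg fun m => ENNReal.toReal_nonneg
  have hxl : -1 ≤ x * Real.log x := by
    rcases hx0.eq_or_lt with h0 | h0
    · simp [← h0]
    · have := mul_le_mul_of_nonneg_left (Real.one_sub_inv_le_log_of_pos h0) hx0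
      rw [mul_sub, mul_inv_cancel₀ h0.ne'] at this
      linarith
  nlinarith

theorem toReal_dpsWeight {n : ℕ} (H : Fin n → Obs S A h) (z : Obs S A h) :
    (dpsWeight p₀ μp μr ν H z).toReal =
      ∑ π, (dpsPolicy p₀ μp μr H π).toReal * (duelWeight p₀ ν π z).toReal := by
  rw [dpsWeight, ENNReal.toReal_sum fun π _ =>
    ENNReal.mul_ne_top (PMF.apply_ne_top _ _) (duelWeight_ne_top p₀ ν π z)]
  simp only [ENNReal.toReal_mul]

/-- The gain of `x log x` in one iteration that follows the history `H`, weighted with the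
probability of `H`. -/
def logGain {n : ℕ} (H : Fin n → Obs S A h) (π : Policy S A h) : ℝ :=
  ∑ z, (dpsWeight p₀ μp μr ν H z).toReal *
      (∫ m, (obsRun p₀ μp μr ν m n H).toReal * (optPolicy p₀ m.1 m.2 π).toReal *
        (obsLik m z).toReal ∂(μp.prod μr)) *
      Real.log (dpsPolicy p₀ μp μr (Fin.snoc (α := fun _ => Obs S A h) H z) π).toReal -
    (dpsPolicy p₀ μp μr H π).toReal *
      (∫ m, (obsRun p₀ μp μr ν m n H).toReal ∂(μp.prod μr)) *
        Real.log (dpsPolicy p₀ μp μr H π).toReal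

/-- Bayes' rule for one more observation `z`: both sides are the probability that the history `H`
is followed by `z` and that `π` is optimal. -/
theorem weighted_posterior_snoc {n : ℕ} (H : Fin n → Obs S A h) (π : Policy S A h)
    (z : Obs S A h) :
    (dpsWeight p₀ μp μr ν H z).toReal *
      (∫ m, (obsRun p₀ μp μr ν m n H).toReal * (optPolicy p₀ m.1 m.2 π).toReal *
        (obsLik m z).toReal ∂(μp.prod μr)) =
    (dpsPolicy p₀ μp μr (Fin.snoc (α := fun _ => Obs S A h) H z) π).toReal *
      ∫ m, (obsRun p₀ μp μr ν m (n + 1) (Fin.snoc (α := fun _ => Obs S A h) H z)).toReal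
        ∂(μp.prod μr) := by
  rw [← integral_obsRun_mul_optPolicy, ← integral_const_mul]
  refine integral_congr_ae (ae_of_all _ fun m => ?_)
  simp only [obsRun_snoc, ENNReal.toReal_mul]
  ring

theorem sum_logGain (n : ℕ) (π : Policy S A h) :
    ∑ H : Fin n → Obs S A h, logGain p₀ μp μr ν H π =
      expLogPosterior p₀ μp μr ν (n + 1) π - expLogPosterior p₀ μp μr ν n π := by
  simp only [logGain, Finset.sum_sub_distrib, weighted_posterior_snoc]
  rw [expLogPosterior, expLogPosterior, ← (Fin.snocEquiv (fun _ : Fin (n + 1) => Obs S A h)).sum_comp,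
    Fintype.sum_prod_type_right]
  rfl

/-- One policy's share in the regret after the history `H` is bounded by its information gain. -/
theorem logGain_nonneg_and_sum_le {n : ℕ} (H : Fin n → Obs S A h) (π : Policy S A h) :
    0 ≤ logGain p₀ μp μr ν H π ∧
    ∑ z, (duelWeight p₀ ν π z).toReal *
        |(∫ m, (obsRun p₀ μp μr ν m n H).toReal * (optPolicy p₀ m.1 m.2 π).toReal *
            (obsLik m z).toReal ∂(μp.prod μr)) -
          (dpsPolicy p₀ μp μr H π).toReal *
            ∫ m, (obsRun p₀ μp μr ν m n H).toReal * (obsLik m z).toReal ∂(μp.prod μr)| ≤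
      2 * √((∫ m, (obsRun p₀ μp μr ν m n H).toReal ∂(μp.prod μr)) *
        logGain p₀ μp μr ν H π) := by
  have hq := memLp_top_obsRun p₀ μp μr ν (μp.prod μr) H
  have hqo := MemLp.mul' (q := ⊤) (p := ⊤) (r := ⊤) (memLp_top_optPolicy p₀ (μp.prod μr) π) hq
  have hduel : ∀ m z, duel p₀ ν m π z = duelWeight p₀ ν π z * obsLik m z :=
    fun m z => duel_apply p₀ ν m π z
  have hdps : ∀ m z, ((dpsPolicy p₀ μp μr H).bind (duel p₀ ν m)) z =
      dpsWeight p₀ μp μr ν H z * obsLik m z := fun m z => dps_bind_duel_apply p₀ μp μr ν m H z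
  refine sum_abs_sub_le_sqrt_gain (fun z => ENNReal.toReal_nonneg)
    (fun z => ENNReal.toReal_nonneg)
    (fun z => integral_nonneg fun m => by positivity)
    (fun z => integral_nonneg fun m => by positivity)
    (fun z => ENNReal.toReal_nonneg) ENNReal.toReal_nonneg (fun z => ?_) (fun z => ?_)
    (sum_mul_integral_obsLik hduel hq)
    ((sum_mul_integral_obsLik hduel hqo).trans (integral_obsRun_mul_optPolicy p₀ μp μr ν H π))
    (sum_mul_integral_obsLik hdps hq)
    ((sum_mul_integral_obsLik hdps hqo).trans (integral_obsRun_mul_optPolicy p₀ μp μr ν H π))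
  · rw [toReal_dpsWeight]
    exact Finset.single_le_sum (f := fun π => (dpsPolicy p₀ μp μr H π).toReal *
      (duelWeight p₀ ν π z).toReal) (fun π _ => by positivity) (Finset.mem_univ π)
  · rw [weighted_posterior_snoc, ← integral_const_mul (dpsWeight p₀ μp μr ν H z).toReal]
    congr 1
    refine integral_congr_ae (ae_of_all _ fun m => ?_)
    simp only [obsRun_snoc, ENNReal.toReal_mul]
    ring

theorem integral_roundRegret_le
    (hlink : ∀ᵐ r ∂μr, ∀ τ₁ τ₂ : Traj S A h, |utility r τ₂ - utility r τ₁| ≤ 1 / 2) (n : ℕ) :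
    ∫ m, roundRegret p₀ μp μr ν n m ∂(μp.prod μr) ≤
      ∑ π, √(expLogPosterior p₀ μp μr ν (n + 1) π - expLogPosterior p₀ μp μr ν n π) := by
  set μ := μp.prod μr with hμ
  set g : Obs S A h → ℝ := fun z => if z.2.2 then 1 / 2 else -(1 / 2) with hg
  have hg_abs : ∀ z, |g z| ≤ 1 / 2 := by
    intro z
    simp only [hg]
    split_ifs <;> norm_num [abs_of_pos, abs_neg]
  have hq := memLp_top_obsRun p₀ μp μr ν μ (n := n)
  have hl := memLp_top_obsLik (S := S) (A := A) (h := h) μ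
  have ho := memLp_top_optPolicy (S := S) (A := A) (h := h) p₀ μ
  have hqol : ∀ (H : Fin n → Obs S A h) (π : Policy S A h) (z : Obs S A h), Integrable (fun m => (obsRun p₀ μp μr ν m n H).toReal *
      (optPolicy p₀ m.1 m.2 π).toReal * (obsLik m z).toReal) μ := fun H π z =>
    (MemLp.mul' (q := ⊤) (p := ⊤) (r := ⊤) (hl z)
      (MemLp.mul' (q := ⊤) (p := ⊤) (r := ⊤) (ho π) (hq H))).integrable le_top
  have hql : ∀ (H : Fin n → Obs S A h) (z : Obs S A h), Integrable (fun m => (obsRun p₀ μp μr ν m n H).toReal *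
      (obsLik m z).toReal) μ := fun H z =>
    (MemLp.mul' (q := ⊤) (p := ⊤) (r := ⊤) (hl z) (hq H)).integrable le_top
  -- The values may be shifted by the mean value under `ν`, as both policy laws have mass one;
  -- the shifted values are the means of the labels.
  have hae : ∀ᵐ m ∂μ, roundRegret p₀ μp μr ν n m =
      ∑ H : Fin n → Obs S A h, ∑ π, ∑ z, (duelWeight p₀ ν π z).toReal * g z *
        ((obsRun p₀ μp μr ν m n H).toReal * (optPolicy p₀ m.1 m.2 π).toReal *
            (obsLik m z).toReal -
          (dpsPolicy p₀ μp μr H π).toReal *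
            ((obsRun p₀ μp μr ν m n H).toReal * (obsLik m z).toReal)) := by
    filter_upwards [Measure.quasiMeasurePreserving_snd.ae hlink] with m hm
    unfold roundRegret
    rw [expect]
    refine Finset.sum_congr rfl fun H _ => ?_
    have hshift : ∑ π, ((optPolicy p₀ m.1 m.2 π).toReal - (dpsPolicy p₀ μp μr H π).toReal) *
          value p₀ m.1 m.2 π =
        ∑ π, ((optPolicy p₀ m.1 m.2 π).toReal - (dpsPolicy p₀ μp μr H π).toReal) *
          expect (duel p₀ ν m π) g := by
      simp only [hg, expect_duel_label p₀ ν m _ hm, mul_sub, Finset.sum_sub_distrib,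
        ← Finset.sum_mul, sum_toReal_eq_one]
      ring
    rw [hshift, Finset.mul_sum]
    refine Finset.sum_congr rfl fun π _ => ?_
    rw [expect, Finset.mul_sum, Finset.mul_sum]
    refine Finset.sum_congr rfl fun z _ => ?_
    rw [duel_apply, ENNReal.toReal_mul]
    ring
  have hint : ∀ (H : Fin n → Obs S A h) (π : Policy S A h) (z : Obs S A h), Integrable (fun m => (duelWeight p₀ ν π z).toReal * g z *
        ((obsRun p₀ μp μr ν m n H).toReal * (optPolicy p₀ m.1 m.2 π).toReal *
            (obsLik m z).toReal -
          (dpsPolicy p₀ μp μr H π).toReal *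
            ((obsRun p₀ μp μr ν m n H).toReal * (obsLik m z).toReal))) μ := fun H π z =>
    ((hqol H π z).sub ((hql H z).const_mul _)).const_mul _
  rw [integral_congr_ae hae, integral_finsetSum _ fun H _ => integrable_finsetSum _ fun π _ =>
    integrable_finsetSum _ fun z _ => hint H π z]
  have hstep : ∀ H : Fin n → Obs S A h, ∫ m, ∑ π, ∑ z, (duelWeight p₀ ν π z).toReal * g z *
        ((obsRun p₀ μp μr ν m n H).toReal * (optPolicy p₀ m.1 m.2 π).toReal *
            (obsLik m z).toReal -
          (dpsPolicy p₀ μp μr H π).toReal *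
            ((obsRun p₀ μp μr ν m n H).toReal * (obsLik m z).toReal)) ∂μ ≤
      ∑ π, √((∫ m, (obsRun p₀ μp μr ν m n H).toReal ∂μ) * logGain p₀ μp μr ν H π) := by
    intro H
    rw [integral_finsetSum _ fun π _ => integrable_finsetSum _ fun z _ => hint H π z]
    refine Finset.sum_le_sum fun π _ => ?_
    rw [integral_finsetSum _ fun z _ => hint H π z]
    have h2 := (logGain_nonneg_and_sum_le p₀ μp μr ν H π).2
    refine le_trans (b := (1 / 2) * ∑ z, (duelWeight p₀ ν π z).toReal *
        |(∫ m, (obsRun p₀ μp μr ν m n H).toReal * (optPolicy p₀ m.1 m.2 π).toReal *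
            (obsLik m z).toReal ∂μ) - (dpsPolicy p₀ μp μr H π).toReal *
            ∫ m, (obsRun p₀ μp μr ν m n H).toReal * (obsLik m z).toReal ∂μ|) ?_ (by linarith)
    rw [Finset.mul_sum]
    refine Finset.sum_le_sum fun z _ => ?_
    rw [integral_const_mul, integral_sub (hqol H π z) ((hql H z).const_mul _), integral_const_mul]
    refine (le_abs_self _).trans ?_
    rw [abs_mul, abs_mul, abs_of_nonneg ENNReal.toReal_nonneg, mul_left_comm, mul_assoc]
    exact mul_le_mul_of_nonneg_left
      (mul_le_mul_of_nonneg_right (hg_abs z) (abs_nonneg _)) ENNReal.toReal_nonneg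
  refine (Finset.sum_le_sum fun H _ => hstep H).trans ?_
  rw [Finset.sum_comm]
  refine Finset.sum_le_sum fun π _ => ?_
  rw [← sum_logGain]
  have hw : ∀ H : Fin n → Obs S A h, 0 ≤ ∫ m, (obsRun p₀ μp μr ν m n H).toReal ∂μ :=
    fun H => integral_nonneg fun m => ENNReal.toReal_nonneg
  simp only [Real.sqrt_mul (hw _)]
  refine (Real.sum_sqrt_mul_sqrt_le _ hw
    fun H => (logGain_nonneg_and_sum_le p₀ μp μr ν H π).1).trans_eq ?_
  rw [sum_integral_obsRun, Real.sqrt_one, one_mul]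

/-! ### The total regret -/

/-- The Bayesian regret grows more slowly than the square root of the number of iterations. -/
theorem eventually_bayesRegret_le {Sr : ℝ} (hSr : ∀ᵐ r ∂μr, ‖r‖ ≤ Sr)
    (hlink : ∀ᵐ r ∂μr, ∀ τ₁ τ₂ : Traj S A h, |utility r τ₂ - utility r τ₁| ≤ 1 / 2)
    {δ : ℝ} (hδ : 0 < δ) :
    ∀ᶠ N : ℕ in atTop, bayesRegret p₀ μp μr ν N ≤ δ * √(N : ℝ) := by
  set D : Policy S A h → ℕ → ℝ := fun π n =>
    expLogPosterior p₀ μp μr ν (n + 1) π - expLogPosterior p₀ μp μr ν n π with hD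
  have hD0 : ∀ π n, 0 ≤ D π n := by
    intro π n
    simp only [hD, ← sum_logGain]
    exact Finset.sum_nonneg fun H _ => (logGain_nonneg_and_sum_le p₀ μp μr ν H π).1
  have hDs : ∀ π, Summable (D π) := by
    intro π
    refine summable_of_sum_range_le (c := 1) (hD0 π) fun N => ?_
    simp only [hD, Finset.sum_range_sub (fun n => expLogPosterior p₀ μp μr ν n π)]
    linarith [expLogPosterior_nonpos p₀ μp μr ν N π, neg_one_le_expLogPosterior p₀ μp μr ν 0 π]
  have hcard : 0 < (Fintype.card (Policy S A h) : ℝ) := by exact_mod_cast Fintype.card_pos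
  filter_upwards [eventually_all.2 fun π =>
    eventually_sum_sqrt_le (hD0 π) (hDs π) (div_pos hδ hcard)] with N hN
  have hsum : bayesRegret p₀ μp μr ν N =
      ∑ n ∈ Finset.range N, ∫ m, roundRegret p₀ μp μr ν n m ∂(μp.prod μr) := by
    simp only [bayesRegret, condRegret_eq_sum]
    exact integral_finsetSum _ fun n _ => integrable_roundRegret p₀ μp μr ν hSr n
  calc bayesRegret p₀ μp μr ν N ≤ ∑ n ∈ Finset.range N, ∑ π, √(D π n) := by
        rw [hsum]
        exact Finset.sum_le_sum fun n _ => integral_roundRegret_le p₀ μp μr ν hlink n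
    _ = ∑ π, ∑ n ∈ Finset.range N, √(D π n) := Finset.sum_comm
    _ ≤ ∑ _π : Policy S A h, δ / Fintype.card (Policy S A h) * √(N : ℝ) :=
        Finset.sum_le_sum fun π _ => hN π
    _ = δ * √(N : ℝ) := by
        rw [Finset.sum_const, Finset.card_univ, nsmul_eq_mul]
        field_simp

/-- If there is only one policy, there is no regret. -/
theorem bayesRegret_eq_zero [Subsingleton (Policy S A h)] (N : ℕ) :
    bayesRegret p₀ μp μr ν N = 0 := by
  have h1 : ∀ n m, roundRegret p₀ μp μr ν n m = 0 := by
    intro n m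
    have h2 : ∀ (q : PMF (Policy S A h)) (π : Policy S A h), (q π).toReal = 1 := by
      intro q π
      rw [← sum_toReal_eq_one q, Fintype.sum_subsingleton _ π]
    simp [roundRegret, h2, expect_const]
  simp [bayesRegret, condRegret_eq_sum, h1]

end DPS

end

theorem theorem2 {S A : Type*} [Fintype S] [DecidableEq S] [Fintype A] [DecidableEq A] (h : ℕ)
    [Nonempty (DPS.Policy S A h)] (p₀ : PMF S)
    (μp : Measure (DPS.Dynamics S A)) [IsProbabilityMeasure μp]
    (μr : Measure (DPS.Rewards S A)) [IsProbabilityMeasure μr]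
    (Sr : ℝ) (hSr : ∀ᵐ r ∂μr, ‖r‖ ≤ Sr)
    (hlink : ∀ᵐ r ∂μr, ∀ τ₁ τ₂ : DPS.Traj S A h,
      |DPS.utility r τ₂ - DPS.utility r τ₁| ≤ 1 / 2)
    (ν : PMF (DPS.Policy S A h)) :
    (∀ N : ℕ, Integrable (DPS.condRegret p₀ μp μr ν N) (μp.prod μr)) ∧
    ∀ ε : ℝ, 0 < ε → ∀ᶠ N : ℕ in atTop,
      DPS.bayesRegret p₀ μp μr ν N ≤
        (1 + ε) * ((Fintype.card S : ℝ) *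
          √((Fintype.card A : ℝ) * ((N : ℝ) * (h : ℝ)) * Real.log (Fintype.card A : ℝ) / 2)) := by
  constructor
  · intro N
    simp only [funext (DPS.condRegret_eq_sum p₀ μp μr ν N)]
    exact integrable_finsetSum _ fun n _ => DPS.integrable_roundRegret p₀ μp μr ν hSr n
  intro ε hε
  -- If `h = 0` or `A ≤ 1` the bound is zero, but there is only one policy.
  by_cases hdeg : h = 0 ∨ Fintype.card A ≤ 1
  · have hsub : Subsingleton (DPS.Policy S A h) := by
      rcases hdeg with rfl | hA
      · infer_instance
      · have := Fintype.card_le_one_iff_subsingleton.1 hA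
        infer_instance
    refine Eventually.of_forall fun N => ?_
    rw [DPS.bayesRegret_eq_zero]
    positivity
  push Not at hdeg
  have hS : 0 < (Fintype.card S : ℝ) := by
    obtain ⟨s, _⟩ := p₀.support_nonempty
    exact_mod_cast Fintype.card_pos_iff.2 ⟨s⟩
  have hA : 1 < (Fintype.card A : ℝ) := by exact_mod_cast hdeg.2
  have hh : 0 < (h : ℝ) := by exact_mod_cast Nat.pos_of_ne_zero hdeg.1
  have hC : 0 < (Fintype.card A : ℝ) * h * Real.log (Fintype.card A : ℝ) / 2 := by
    have := Real.log_pos hA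
    positivity
  filter_upwards [DPS.eventually_bayesRegret_le p₀ μp μr ν hSr hlink
    (mul_pos (mul_pos (by linarith : 0 < 1 + ε) hS) (Real.sqrt_pos.2 hC))] with N hN
  refine hN.trans_eq ?_
  rw [show (Fintype.card A : ℝ) * ((N : ℝ) * (h : ℝ)) * Real.log (Fintype.card A : ℝ) / 2 =
    (Fintype.card A : ℝ) * h * Real.log (Fintype.card A : ℝ) / 2 * N by ring,
    Real.sqrt_mul hC.le]
  ring
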